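/- Let $Sol=\mathbb R\ltimes\mathbb R^2$ be the group of triples $(z,x,y)\in\mathbb R^3$ with product $(z,x,y)(z',x',y')=(z+z',\,x+e^{-z}x',\,y+e^{z}y')$, and let $d$ be the distance of the left-invariant Riemannian metric $ds^2=dz^2+e^{2z}dx^2+e^{-2z}dy^2$. For a discrete probability measure $\mu$ on $Sol$ (a measure carried by a countable set, whose support is its set of atoms), let $X_1,X_2,\dots$ be independent random elements of law $\mu$, let $W_n=X_1\cdots X_n=(S_n,U_n,V_n)$ be the associated random walk, and let $\alpha=\int_{Sol} z\,d\mu$ be its vertical drift. We say that $\mu$ has finite first moment if $\int_{Sol} d(\mathrm{id},g)\,d\mu(g)<\infty$, and that $\mu$ is non-degenerate on a subgroup $\Gamma$ if the semigroup generated by the support of $\mu$ equals $\Gamma$. When $\mu$ has finite first moment and $\alpha\neq 0$, the harmonic measure $\nu$ of the random walk is the following probability measure on $\mathbb R$: if $\alpha>0$, the sequence $U_n$ converges almost surely to a real random variable $\xi$ and $\nu$ is the law of $\xi$; if $\alpha<0$, the sequence $V_n$ converges almost surely to a real random variable $\xi'$ and $\nu$ is the law of $\xi'$. Let $\Gamma$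 be a countable subgroup of $Sol$ not contained in the plane $\{z=0\}$. Then there exists a discrete probability measure $\mu$ with finite first moment, non-degenerate on $\Gamma$ and with $\alpha\neq0$, whose harmonic measure $\nu$ is singular with respect to Lebesgue measure on $\mathbb R$. Moreover, $\mu$ can be chosen finitely supported when $\Gamma$ is finitely generated. -/

import Mathlib

open MeasureTheory Filter Topology
open scoped Manifold ENNReal

/-- The group `Sol = ℝ ⋉ ℝ²`, in coordinates `(z, x, y)`. -/
@[ext]
structure Sol where
  z : ℝ
  x : ℝ
  y : ℝ

namespace Sol

noncomputable section

/-- `(z, x, y) (z', x', y') = (z + z', x + e^{-z} x', y + e^{z} y')`. -/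
instance : Mul Sol :=
  ⟨fun g h => ⟨g.z + h.z, g.x + Real.exp (-g.z) * h.x, g.y + Real.exp g.z * h.y⟩⟩

instance : One Sol := ⟨⟨0, 0, 0⟩⟩

instance : Inv Sol := ⟨fun g => ⟨-g.z, -(Real.exp g.z * g.x), -(Real.exp (-g.z) * g.y)⟩⟩

theorem mul_def (g h : Sol) :
    g * h = ⟨g.z + h.z, g.x + Real.exp (-g.z) * h.x, g.y + Real.exp g.z * h.y⟩ := rfl

theorem one_def : (1 : Sol) = ⟨0, 0, 0⟩ := rfl

theorem inv_def (g : Sol) :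
    g⁻¹ = ⟨-g.z, -(Real.exp g.z * g.x), -(Real.exp (-g.z) * g.y)⟩ := rfl

instance : Group Sol :=
  Group.ofLeftAxioms
    (fun a b c => by
      simp only [mul_def, Sol.mk.injEq, neg_add, Real.exp_add]
      exact ⟨by ring, by ring, by ring⟩)
    (fun a => by simp [mul_def, one_def])
    (fun a => by simp [mul_def, one_def, inv_def])

/-- The global coordinates `(z, x, y)`. -/
def equivProd : Sol ≃ ℝ × ℝ × ℝ where
  toFun g := (g.z, g.x, g.y)
  invFun p := ⟨p.1, p.2.1, p.2.2⟩
  left_inv _ := rfl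
  right_inv _ := rfl

instance : TopologicalSpace Sol := TopologicalSpace.induced equivProd inferInstance

instance : MeasurableSpace Sol := borel Sol

instance : BorelSpace Sol := ⟨rfl⟩

/-- The global coordinates `(z, x, y)`, as a homeomorphism onto `ℝ³`. -/
def homeomorphProd : Sol ≃ₜ ℝ × ℝ × ℝ := equivProd.toHomeomorphOfIsInducing ⟨rfl⟩

/-- The manifold structure on `Sol` given by its global chart. -/
instance : ChartedSpace (ℝ × ℝ × ℝ) Sol :=
  homeomorphProd.toOpenPartialHomeomorph.singletonChartedSpace rfl

/-- The norm on the tangent space at `p = (z, x, y)` associated with the left-invariant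
Riemannian metric `ds² = dz² + e^{2z} dx² + e^{-2z} dy²`. -/
instance (p : Sol) : ENorm (TangentSpace 𝓘(ℝ, ℝ × ℝ × ℝ) p) where
  enorm v :=
    let w : ℝ × ℝ × ℝ := v
    ENNReal.ofReal (Real.sqrt
      (w.1 ^ 2 + Real.exp (2 * p.z) * w.2.1 ^ 2 + Real.exp (-(2 * p.z)) * w.2.2 ^ 2))

instance (p : Sol) : ENormSMulClass ℝ (TangentSpace 𝓘(ℝ, ℝ × ℝ × ℝ) p) where
  enorm_smul c v := by
    change ENNReal.ofReal (Real.sqrt ((c * v.1) ^ 2 + Real.exp (2 * p.z) * (c * v.2.1) ^ 2 +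
        Real.exp (-(2 * p.z)) * (c * v.2.2) ^ 2)) =
      ‖c‖ₑ * ENNReal.ofReal (Real.sqrt (v.1 ^ 2 + Real.exp (2 * p.z) * v.2.1 ^ 2 +
        Real.exp (-(2 * p.z)) * v.2.2 ^ 2))
    rw [← ofReal_norm, ← ENNReal.ofReal_mul (norm_nonneg c), Real.norm_eq_abs,
      ← Real.sqrt_sq_eq_abs, ← Real.sqrt_mul (sq_nonneg c)]
    congr 2
    ring

/-- The left-invariant Riemannian distance on `Sol`: the infimum of the lengths of the `C¹` paths
from `g` to `h` for the metric `ds² = dz² + e^{2z} dx² + e^{-2z} dy²`. -/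
def riemannianDist (g h : Sol) : ℝ≥0∞ := Manifold.riemannianEDist 𝓘(ℝ, ℝ × ℝ × ℝ) g h

/-- `∫ d(id, g) dμ(g) < ∞`. -/
def HasFiniteFirstMoment (μ : Measure Sol) : Prop := ∫⁻ g, riemannianDist 1 g ∂μ < ∞

/-- `μ` is non-degenerate on `Γ`: the semigroup generated by the support (the set of atoms) of the
discrete probability measure `μ` is the group `Γ`. -/
def IsNondegenerateOn (μ : PMF Sol) (Γ : Subgroup Sol) : Prop :=
  (Subsemigroup.closure μ.support : Set Sol) = Γ

/-- The vertical drift `α`, i.e. the mean of the `z`-component of `μ`. -/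
def drift (μ : Measure Sol) : ℝ := ∫ g, g.z ∂μ

/-- The position `W_n = X_1 ⋯ X_n` of the walk started at the identity with increments
`X_{j+1} = X j`. -/
def walk (X : ℕ → Sol) : ℕ → Sol
  | 0 => 1
  | n + 1 => walk X n * X n

/-- `ν` is the harmonic measure on the boundary of the random walk of increment law `μ`. Under the
infinite product law `μ^ℕ` of the increments, if the drift is positive then `ν` is the law of the
almost sure limit `ξ` of the `x`-coordinates of the walk (`ν` lives on the boundary line of upward
vertical geodesics); if the drift is negative then `ν` is the law of the almost sure limit of
the `y`-coordinates (`ν` lives on the boundary line of downward vertical geodesics). -/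
def IsHarmonicMeasure (μ : Measure Sol) [IsProbabilityMeasure μ] (ν : Measure ℝ) : Prop :=
  (0 < drift μ ∧ ∃ ξ : (ℕ → Sol) → ℝ, Measurable ξ ∧
    (∀ᵐ X ∂Measure.infinitePi (fun _ : ℕ => μ),
      Tendsto (fun n => (walk X n).x) atTop (𝓝 (ξ X))) ∧
    ν = (Measure.infinitePi (fun _ : ℕ => μ)).map ξ) ∨
  (drift μ < 0 ∧ ∃ ξ : (ℕ → Sol) → ℝ, Measurable ξ ∧
    (∀ᵐ X ∂Measure.infinitePi (fun _ : ℕ => μ),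
      Tendsto (fun n => (walk X n).y) atTop (𝓝 (ξ X))) ∧
    ν = (Measure.infinitePi (fun _ : ℕ => μ)).map ξ)

end

end Sol

/-! The idea is to let the drift outrun a code for the trajectories. Increments are read as letters
indexed by `ℕ`, and letter `j` costs `j + 1` bits. Intervals around the words of length `n`, of
radius `e^{-cn}` times `2^{-bits}`, have total length `2 e^{-cn}` (`volume_wordCover_le`), so their
limsup is null by Borel–Cantelli. A typical word uses about `(m + 1) n` bits, `m` being the mean
index, while the `x`-coordinate converges at any exponential rate below the drift `α`. If `α > (m +
1) log 2`, the limit lies in these intervals eventually (`eventually_mem_wordCover`), and its law is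
singular. To reach this regime, fix the law of the indices and replace only letter `0` by `g ^ k`
with `g.z > 0`: the drift grows linearly in `k`, while `m` does not move. -/

namespace Sol

/-! ### Finiteness of the Riemannian distance -/

/-- The straight path from the identity, in the global coordinates. -/
def line (g : Sol) (t : ℝ) : Sol := ⟨t * g.z, t * g.x, t * g.y⟩

instance (n : WithTop ℕ∞) : IsManifold 𝓘(ℝ, ℝ × ℝ × ℝ) n Sol :=
  homeomorphProd.toOpenPartialHomeomorph.isManifold_singleton rfl

theorem contMDiff_line (g : Sol) : ContMDiff 𝓘(ℝ, ℝ) 𝓘(ℝ, ℝ × ℝ × ℝ) 1 (line g) := by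
  rw [contMDiff_iff]
  refine ⟨homeomorphProd.isInducing.continuous_iff.2 ?_, fun x y => ?_⟩
  · change Continuous fun t : ℝ => (t * g.z, t * g.x, t * g.y)
    fun_prop
  · change ContDiffOn ℝ 1 (fun t : ℝ => (t * g.z, t * g.x, t * g.y)) _
    fun_prop

theorem mfderiv_line (g : Sol) (t : ℝ) :
    (mfderiv 𝓘(ℝ, ℝ) 𝓘(ℝ, ℝ × ℝ × ℝ) (line g) t 1 : ℝ × ℝ × ℝ) = (g.z, g.x, g.y) := by
  have h : HasDerivAt (fun t : ℝ => (t * g.z, t * g.x, t * g.y)) (1 * g.z, 1 * g.x, 1 * g.y) t :=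
    ((hasDerivAt_id t).mul_const _).prodMk
      (((hasDerivAt_id t).mul_const _).prodMk ((hasDerivAt_id t).mul_const _))
  have hm : HasMFDerivAt 𝓘(ℝ, ℝ) 𝓘(ℝ, ℝ × ℝ × ℝ) (line g) t
      (ContinuousLinearMap.toSpanSingleton ℝ ((1 * g.z, 1 * g.x, 1 * g.y) : ℝ × ℝ × ℝ)) :=
    ⟨(contMDiff_line g).continuous.continuousAt, h.hasFDerivAt.hasFDerivWithinAt⟩
  rw [hm.mfderiv]
  change (1 : ℝ) • ((1 * g.z, 1 * g.x, 1 * g.y) : ℝ × ℝ × ℝ) = _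
  simp

theorem riemannianDist_one_lt_top (g : Sol) : riemannianDist 1 g < ∞ := by
  have hle : riemannianDist 1 g ≤ Manifold.pathELength 𝓘(ℝ, ℝ × ℝ × ℝ) (line g) 0 1 :=
    Manifold.riemannianEDist_le_pathELength (contMDiff_line g).contMDiffOn
      (by simp [line, one_def]) (by simp [line]) zero_le_one
  refine hle.trans_lt ?_
  rw [Manifold.pathELength_eq_lintegral_mfderiv_Icc]
  have hbound : ∀ t ∈ Set.Icc (0 : ℝ) 1,
      ‖mfderiv 𝓘(ℝ, ℝ) 𝓘(ℝ, ℝ × ℝ × ℝ) (line g) t 1‖ₑ ≤ ENNReal.ofReal (Real.sqrt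
        (g.z ^ 2 + Real.exp (2 * |g.z|) * g.x ^ 2 + Real.exp (2 * |g.z|) * g.y ^ 2)) := by
    intro t ht
    change ENNReal.ofReal (Real.sqrt
      ((mfderiv 𝓘(ℝ, ℝ) 𝓘(ℝ, ℝ × ℝ × ℝ) (line g) t 1 : ℝ × ℝ × ℝ).1 ^ 2 +
      Real.exp (2 * (t * g.z)) *
        (mfderiv 𝓘(ℝ, ℝ) 𝓘(ℝ, ℝ × ℝ × ℝ) (line g) t 1 : ℝ × ℝ × ℝ).2.1 ^ 2 +
      Real.exp (-(2 * (t * g.z))) *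
        (mfderiv 𝓘(ℝ, ℝ) 𝓘(ℝ, ℝ × ℝ × ℝ) (line g) t 1 : ℝ × ℝ × ℝ).2.2 ^ 2)) ≤ _
    rw [mfderiv_line]
    have habs : |t * g.z| ≤ |g.z| := by
      rw [abs_mul, abs_of_nonneg ht.1]
      exact mul_le_of_le_one_left (abs_nonneg _) ht.2
    have h1 := (le_abs_self _).trans habs
    have h2 := (neg_le_abs _).trans habs
    dsimp only
    gcongr
    linarith
  refine (setLIntegral_mono' measurableSet_Icc hbound).trans_lt ?_
  simp [ENNReal.ofReal_lt_top]

/-! ### Coordinates of the walk and rate of convergence -/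

theorem continuous_z : Continuous Sol.z :=
  continuous_fst.comp homeomorphProd.continuous

theorem continuous_x : Continuous Sol.x :=
  continuous_fst.comp (continuous_snd.comp homeomorphProd.continuous)

theorem walk_z (X : ℕ → Sol) (n : ℕ) : (walk X n).z = ∑ i ∈ Finset.range n, (X i).z := by
  induction n with
  | zero => rfl
  | succ n ih => rw [Finset.sum_range_succ, ← ih]; rfl

theorem walk_x_succ (X : ℕ → Sol) (n : ℕ) :
    (walk X (n + 1)).x =
      (walk X n).x + Real.exp (-∑ i ∈ Finset.range n, (X i).z) * (X n).x := by
  rw [← walk_z]; rfl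

theorem walk_congr {X Y : ℕ → Sol} {n : ℕ} (h : ∀ i < n, X i = Y i) : walk X n = walk Y n := by
  induction n with
  | zero => rfl
  | succ n ih =>
    simp only [walk]
    rw [ih fun i hi => h i (by omega), h n (by omega)]

theorem measurable_walk_x (n : ℕ) : Measurable fun X : ℕ → Sol => (walk X n).x := by
  induction n with
  | zero => exact measurable_const
  | succ n ih =>
    simp only [walk_x_succ]
    have hz : Measurable Sol.z := continuous_z.measurable
    have hx : Measurable Sol.x := continuous_x.measurable
    fun_prop

/-- If the mean height grows at a speed more than `β` and the mean horizontal displacement is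
bounded, the horizontal increments decay like `e^{-βn}`. -/
theorem exists_dist_walk_x_le {X : ℕ → Sol} {α β M : ℝ} (hβ : β < α)
    (hz : Tendsto (fun n : ℕ => (∑ i ∈ Finset.range n, (X i).z) / n) atTop (𝓝 α))
    (hx : Tendsto (fun n : ℕ => (∑ i ∈ Finset.range n, |(X i).x|) / n) atTop (𝓝 M)) :
    ∃ C : ℝ, ∀ n, dist (walk X n).x (walk X (n + 1)).x ≤ C * Real.exp (-β) ^ n := by
  -- The gap between `β` and `β'` absorbs the linear bound on the `n`-th horizontal increment.
  obtain ⟨β', h1, h2⟩ := exists_between hβ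
  have hO : (fun n : ℕ => dist (walk X n).x (walk X (n + 1)).x) =O[atTop]
      fun n : ℕ => Real.exp (-β) ^ n := by
    have hlt : ‖Real.exp (-β')‖ < Real.exp (-β) := by
      rw [Real.norm_eq_abs, Real.abs_exp]
      exact Real.exp_lt_exp.2 (by linarith)
    refine Asymptotics.IsBigO.trans ?_
      (isLittleO_pow_const_mul_const_pow_const_pow_of_norm_lt 1 hlt).isBigO
    refine Asymptotics.IsBigO.of_bound (2 * (M + 1)) ?_
    filter_upwards [hz.eventually (eventually_gt_nhds h2),
      ((tendsto_add_atTop_iff_nat 1).2 hx).eventually (eventually_lt_nhds (lt_add_one M)),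
      eventually_ge_atTop 1] with n hn1 hn2 hn3
    have hn : (1 : ℝ) ≤ n := by exact_mod_cast hn3
    have hS : β' * n ≤ ∑ i ∈ Finset.range n, (X i).z := by
      rw [lt_div_iff₀ (by linarith)] at hn1
      exact hn1.le
    have hX : |(X n).x| ≤ 2 * (M + 1) * n := by
      have h3 : |(X n).x| ≤ ∑ i ∈ Finset.range (n + 1), |(X i).x| :=
        Finset.single_le_sum (f := fun i => |(X i).x|) (fun i _ => abs_nonneg _)
          (Finset.self_mem_range_succ n)
      rw [div_lt_iff₀ (by positivity)] at hn2
      push_cast at hn2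
      have : 0 < M + 1 := by
        by_contra hneg
        have := abs_nonneg (X n).x
        nlinarith
      nlinarith
    have hexp : Real.exp (-∑ i ∈ Finset.range n, (X i).z) ≤ Real.exp (-β') ^ n := by
      rw [← Real.exp_nat_mul]
      exact Real.exp_le_exp.2 (by linarith)
    rw [Real.dist_eq, walk_x_succ, sub_add_cancel_left, norm_abs_eq_norm, norm_neg, norm_mul,
      Real.norm_eq_abs, Real.abs_exp, Real.norm_eq_abs, Real.norm_of_nonneg (by positivity)]
    calc _ ≤ Real.exp (-β') ^ n * (2 * (M + 1) * n) := by gcongr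
      _ = _ := by ring
  obtain ⟨C, -, hC⟩ := Asymptotics.bound_of_isBigO_nat_atTop hO
  refine ⟨C, fun n => ?_⟩
  have := hC (x := n) (by positivity)
  rwa [Real.norm_of_nonneg dist_nonneg, Real.norm_of_nonneg (by positivity)] at this

/-! ### Small covers indexed by words -/

/-- The union over the words `j` of length `n` of the interval centred at the horizontal coordinate
of the word, of radius `e^{-cn}` times the weight `∏ 2^{-(j_i + 1)}` of the word. -/
def wordCover (d : ℕ → Sol) (c : ℝ) (n : ℕ) : Set ℝ :=
  ⋃ j : Fin n → ℕ, Metric.closedBall (walk (fun i => if h : i < n then d (j ⟨i, h⟩) else 1) n).x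
    (Real.exp (-c) ^ n * ∏ i, (1 / 2 : ℝ) ^ (j i + 1))

theorem tsum_pi_prod_eq_pow (f : ℕ → ℝ≥0∞) (n : ℕ) :
    ∑' j : Fin n → ℕ, ∏ i, f (j i) = (∑' k, f k) ^ n := by
  induction n with
  | zero => simp
  | succ n ih =>
    rw [← (Fin.consEquiv fun _ => ℕ).tsum_eq, pow_succ', ← ih, ← ENNReal.tsum_mul_right,
      ENNReal.tsum_prod']
    simp [Fin.consEquiv, Fin.prod_univ_succ, ENNReal.tsum_mul_left]

/-- Kraft's equality: the weights of the words of length `n` sum to `(∑ 2^{-(k+1)})^n = 1`. -/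
theorem volume_wordCover_le (d : ℕ → Sol) (c : ℝ) (n : ℕ) :
    volume (wordCover d c n) ≤ 2 * ENNReal.ofReal (Real.exp (-c)) ^ n := by
  refine (measure_iUnion_le _).trans ?_
  have h1 : ∀ j : Fin n → ℕ, ENNReal.ofReal (2 * (Real.exp (-c) ^ n *
      ∏ i, (1 / 2 : ℝ) ^ (j i + 1))) =
      2 * ENNReal.ofReal (Real.exp (-c)) ^ n * ∏ i, (2⁻¹ : ℝ≥0∞) ^ (j i + 1) := by
    intro j
    rw [ENNReal.ofReal_mul (by norm_num), ENNReal.ofReal_mul (by positivity),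
      ENNReal.ofReal_pow (by positivity), ENNReal.ofReal_prod_of_nonneg (fun _ _ => by positivity),
      mul_assoc]
    simp [ENNReal.ofReal_pow, ENNReal.ofReal_inv_of_pos, ENNReal.inv_pow]
  simp only [Real.volume_closedBall, h1]
  rw [ENNReal.tsum_mul_left, tsum_pi_prod_eq_pow fun k => (2⁻¹ : ℝ≥0∞) ^ (k + 1),
    ENNReal.tsum_geometric_add_one]
  simp [ENNReal.inv_mul_cancel]

/-- The word read off `J` has weight at least `e^{-hn}` for large `n`, so its interval has radius at
least `e^{-(c+h)n}`; the distance left to the limit is `O(e^{-βn})` with `β > c + h`. -/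
theorem eventually_mem_wordCover {d : ℕ → Sol} {J : ℕ → ℕ} {α M m c h ℓ : ℝ}
    (hz : Tendsto (fun n : ℕ => (∑ i ∈ Finset.range n, (d (J i)).z) / n) atTop (𝓝 α))
    (hx : Tendsto (fun n : ℕ => (∑ i ∈ Finset.range n, |(d (J i)).x|) / n) atTop (𝓝 M))
    (hJ : Tendsto (fun n : ℕ => (∑ i ∈ Finset.range n, (J i : ℝ)) / n) atTop (𝓝 m))
    (hh : Real.log 2 * (m + 1) < h) (hc : 0 < c) (hm : 0 ≤ h) (hα : c + h < α)
    (hℓ : Tendsto (fun n => (walk (fun i => d (J i)) n).x) atTop (𝓝 ℓ)) :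
    ∀ᶠ n in atTop, ℓ ∈ wordCover d c n := by
  obtain ⟨β, hβ1, hβ2⟩ := exists_between hα
  obtain ⟨C, hC⟩ := exists_dist_walk_x_le hβ2 hz hx
  have hr : Real.exp (-β) < 1 := Real.exp_zero ▸ Real.exp_lt_exp.2 (by linarith)
  have hdist := dist_le_of_le_geometric_of_tendsto _ C hr hC hℓ
  have hsmall : ∀ᶠ n : ℕ in atTop,
      C * Real.exp (-β) ^ n / (1 - Real.exp (-β)) ≤ Real.exp (-(c + h)) ^ n := by
    have h0 : Tendsto (fun n : ℕ => C / (1 - Real.exp (-β)) * Real.exp (-(β - (c + h))) ^ n) atTop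
        (𝓝 (C / (1 - Real.exp (-β)) * 0)) :=
      (tendsto_pow_atTop_nhds_zero_of_lt_one (Real.exp_pos _).le
        (Real.exp_zero ▸ Real.exp_lt_exp.2 (by linarith))).const_mul _
    rw [mul_zero] at h0
    filter_upwards [h0.eventually (eventually_lt_nhds one_pos)] with n hn
    have h2 : Real.exp (-β) = Real.exp (-(β - (c + h))) * Real.exp (-(c + h)) := by
      rw [← Real.exp_add]; ring_nf
    calc C * Real.exp (-β) ^ n / (1 - Real.exp (-β))
        = C / (1 - Real.exp (-β)) * Real.exp (-β) ^ n := by ring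
      _ = (C / (1 - Real.exp (-β)) * Real.exp (-(β - (c + h))) ^ n) * Real.exp (-(c + h)) ^ n := by
          nth_rw 2 [h2]; rw [mul_pow]; ring
      _ ≤ 1 * Real.exp (-(c + h)) ^ n := by gcongr
      _ = _ := one_mul _
  have hlog : 0 < Real.log 2 := Real.log_pos (by norm_num)
  have hm' : m < h / Real.log 2 - 1 := by
    rw [lt_sub_iff_add_lt, lt_div_iff₀ hlog]; linarith
  filter_upwards [hsmall, hJ.eventually (eventually_lt_nhds hm'), eventually_ge_atTop 1]
    with n hn1 hn2 hn3
  have hn : (1 : ℝ) ≤ n := by exact_mod_cast hn3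
  refine Set.mem_iUnion.2 ⟨fun i => J i, ?_⟩
  rw [walk_congr (Y := fun i => d (J i)) (fun i hi => by simp [hi]), Metric.mem_closedBall,
    dist_comm]
  refine (hdist n).trans (hn1.trans ?_)
  rw [neg_add, Real.exp_add, mul_pow, Finset.prod_pow_eq_pow_sum]
  gcongr
  have h2 : (1 / 2 : ℝ) = Real.exp (-Real.log 2) := by
    rw [Real.exp_neg, Real.exp_log two_pos, one_div]
  rw [h2, ← Real.exp_nat_mul, ← Real.exp_nat_mul, Real.exp_le_exp]
  rw [div_lt_iff₀ (by linarith)] at hn2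
  rw [Fin.sum_univ_eq_sum_range (fun i => J i + 1) n, Finset.sum_add_distrib]
  push_cast
  simp only [Finset.sum_const, Finset.card_range, nsmul_eq_mul, mul_one]
  have h5 := mul_le_mul_of_nonneg_right hn2.le hlog.le
  have h6 : (h / Real.log 2 - 1) * n * Real.log 2 = h * n - n * Real.log 2 := by
    field_simp
  nlinarith

/-! ### Law of large numbers and singularity criterion -/

theorem ae_tendsto_average_infinitePi {Ω : Type*} [MeasurableSpace Ω] (ρ : Measure Ω)
    [IsProbabilityMeasure ρ] {f : Ω → ℝ} (hfm : Measurable f) (hf : Integrable f ρ) :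
    ∀ᵐ J ∂Measure.infinitePi (fun _ : ℕ => ρ),
      Tendsto (fun n : ℕ => (∑ i ∈ Finset.range n, f (J i)) / n) atTop (𝓝 (∫ k, f k ∂ρ)) := by
  have hmp : ∀ i : ℕ, MeasurePreserving (fun J : ℕ → Ω => J i)
      (Measure.infinitePi fun _ : ℕ => ρ) ρ :=
    measurePreserving_eval_infinitePi (fun _ : ℕ => ρ)
  have hid : ∀ i : ℕ, ProbabilityTheory.IdentDistrib (fun J : ℕ → Ω => f (J i))
      (fun J => f (J 0)) (Measure.infinitePi fun _ : ℕ => ρ) (Measure.infinitePi fun _ : ℕ => ρ) := by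
    intro i
    refine ⟨(hfm.comp (measurable_pi_apply i)).aemeasurable,
      (hfm.comp (measurable_pi_apply 0)).aemeasurable, ?_⟩
    change Measure.map (f ∘ fun J : ℕ → Ω => J i) _ = Measure.map (f ∘ fun J : ℕ → Ω => J 0) _
    rw [← Measure.map_map hfm (measurable_pi_apply i), ← Measure.map_map hfm (measurable_pi_apply 0),
      (hmp i).map_eq, (hmp 0).map_eq]
  have hind : ProbabilityTheory.iIndepFun (fun (i : ℕ) (J : ℕ → Ω) => f (J i))
      (Measure.infinitePi fun _ : ℕ => ρ) :=
    ProbabilityTheory.iIndepFun_infinitePi (X := fun _ : ℕ => f) fun _ => hfm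
  have h := ProbabilityTheory.strong_law_ae_real (fun (i : ℕ) (J : ℕ → Ω) => f (J i))
    ((hmp 0).integrable_comp_of_integrable hf) (fun i j hij => hind.indepFun hij) hid
  have hint : ∫ J, f (J 0) ∂(Measure.infinitePi fun _ : ℕ => ρ) = ∫ k, f k ∂ρ := by
    have h1 := integral_map (μ := Measure.infinitePi fun _ : ℕ => ρ) (φ := fun J : ℕ → Ω => J 0)
      (measurable_pi_apply 0).aemeasurable (f := f) hfm.aestronglyMeasurable
    rw [(hmp 0).map_eq] at h1
    exact h1.symm
  rwa [hint] at h

/-- If the drift exceeds the mean length of a binary prefix code for the increments, then the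
harmonic measure exists and is singular. -/
theorem exists_isHarmonicMeasure_mutuallySingular (ρ : PMF ℕ) (d : ℕ → Sol)
    (hz : Integrable (fun n => (d n).z) ρ.toMeasure)
    (hx : Integrable (fun n => |(d n).x|) ρ.toMeasure)
    (hJ : Integrable (fun n : ℕ => (n : ℝ)) ρ.toMeasure)
    (h : Real.log 2 * (∫ n, (n : ℝ) ∂ρ.toMeasure + 1) < ∫ n, (d n).z ∂ρ.toMeasure) :
    ∃ ν : Measure ℝ, IsHarmonicMeasure (ρ.map d).toMeasure ν ∧ ν ⟂ₘ volume := by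
  have hd : Measurable d := measurable_of_countable d
  have hpos : 0 ≤ Real.log 2 * (∫ n, (n : ℝ) ∂ρ.toMeasure + 1) :=
    mul_nonneg (Real.log_nonneg (by norm_num))
      (add_nonneg (integral_nonneg fun n => Nat.cast_nonneg n) zero_le_one)
  -- Working with indices rather than increments lets `d` repeat values.
  have hmap : Measure.infinitePi (fun _ : ℕ => (ρ.map d).toMeasure) =
      (Measure.infinitePi fun _ : ℕ => ρ.toMeasure).map fun J i => d (J i) := by
    rw [Measure.infinitePi_map_pi (f := fun _ : ℕ => d) _ fun _ => hd]
    simp only [PMF.toMeasure_map d ρ hd]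
  have hdm : Measurable fun (J : ℕ → ℕ) (i : ℕ) => d (J i) := by fun_prop
  obtain ⟨h', h1, h2⟩ := exists_between h
  obtain ⟨c, hc1, hc2⟩ : ∃ c : ℝ, 0 < c ∧ c + h' < ∫ n, (d n).z ∂ρ.toMeasure :=
    ⟨(∫ n, (d n).z ∂ρ.toMeasure - h') / 2, by linarith, by linarith⟩
  have hLz := ae_tendsto_average_infinitePi ρ.toMeasure (measurable_of_countable _) hz
  have hLx := ae_tendsto_average_infinitePi ρ.toMeasure (measurable_of_countable _) hx
  have hLJ := ae_tendsto_average_infinitePi ρ.toMeasure (measurable_of_countable _) hJ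
  have hconv : ∀ᵐ X ∂Measure.infinitePi (fun _ : ℕ => (ρ.map d).toMeasure),
      ∃ l : ℝ, Tendsto (fun n => (walk X n).x) atTop (𝓝 l) := by
    rw [hmap, ae_map_iff hdm.aemeasurable (measurableSet_exists_tendsto measurable_walk_x)]
    filter_upwards [hLz, hLx] with J h3 h4
    obtain ⟨β, hβ, hβ'⟩ := exists_between (hpos.trans_lt h)
    obtain ⟨C, hC⟩ := exists_dist_walk_x_le hβ' h3 h4
    exact cauchySeq_tendsto_of_complete (cauchySeq_of_le_geometric _ C
      (Real.exp_zero ▸ Real.exp_lt_exp.2 (by linarith)) hC)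
  obtain ⟨ξ, hξ, hlim⟩ := measurable_limit_of_tendsto_metrizable_ae
    (fun n => (measurable_walk_x n).aemeasurable) hconv
  have hdrift : drift (ρ.map d).toMeasure = ∫ n, (d n).z ∂ρ.toMeasure := by
    rw [drift, ← PMF.toMeasure_map d ρ hd, integral_map hd.aemeasurable]
    exact continuous_z.measurable.aestronglyMeasurable
  refine ⟨_, Or.inl ⟨hdrift ▸ hpos.trans_lt h, ξ, hξ, hlim, rfl⟩, ?_⟩
  have hnull : volume (limsup (wordCover d c) atTop) = 0 := by
    apply measure_limsup_atTop_eq_zero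
    refine ne_top_of_le_ne_top ?_ (ENNReal.tsum_le_tsum fun n => volume_wordCover_le d c n)
    rw [ENNReal.tsum_mul_left, ENNReal.tsum_geometric]
    refine ENNReal.mul_ne_top ENNReal.ofNat_ne_top (ENNReal.inv_ne_top.2 ?_)
    rw [← pos_iff_ne_zero, tsub_pos_iff_lt, ENNReal.ofReal_lt_one]
    exact Real.exp_zero ▸ Real.exp_lt_exp.2 (by linarith)
  -- A measurable hull of the same volume avoids proving the limsup measurable.
  refine Measure.MutuallySingular.mk (s := (toMeasurable volume (limsup (wordCover d c) atTop))ᶜ)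
    (t := toMeasurable volume (limsup (wordCover d c) atTop)) ?_
    (by rwa [measure_toMeasurable]) (by simp)
  rw [hmap] at hlim ⊢
  rw [Measure.map_map hξ hdm, Measure.map_apply (hξ.comp hdm) (measurableSet_toMeasurable _ _).compl]
  refine measure_mono_null (fun J hJ' => ?_) (ae_iff (p := fun J : ℕ → ℕ =>
    ξ (fun i => d (J i)) ∈ limsup (wordCover d c) atTop) |>.1 ?_)
  · exact fun hmem => hJ' (subset_toMeasurable _ _ hmem)
  · filter_upwards [hLz, hLx, hLJ, ae_of_ae_map hdm.aemeasurable hlim] with J h3 h4 h5 h6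
    exact mem_limsup_iff_frequently_mem.2
      (eventually_mem_wordCover h3 h4 h5 h1 hc1 (hpos.trans h1.le) hc2 h6).frequently

/-! ### Weights and generating sequences -/

theorem exists_pmf_tsum_mul_ne_top {G : ℕ → ℝ≥0∞} (hG : ∀ n, G n ≠ ∞) :
    ∃ ρ : PMF ℕ, (∀ n, ρ n ≠ 0) ∧ ∑' n, ρ n * G n ≠ ∞ := by
  let w : ℕ → ℝ≥0∞ := fun n => 2⁻¹ ^ (n + 1) * (1 + G n)⁻¹
  have hgeo : ∑' n : ℕ, (2⁻¹ : ℝ≥0∞) ^ (n + 1) ≠ ∞ := by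
    rw [ENNReal.tsum_geometric_add_one]
    simp [ENNReal.inv_mul_cancel]
  have hw0 : ∀ n, w n ≠ 0 := fun n =>
    mul_ne_zero (pow_ne_zero _ (by simp)) (by simp [hG])
  have hwG : ∀ n, w n * (1 + G n) = 2⁻¹ ^ (n + 1) := fun n => by
    rw [mul_assoc, ENNReal.inv_mul_cancel (by simp) (by simp [hG]), mul_one]
  have hle : ∀ n, w n ≤ 2⁻¹ ^ (n + 1) := fun n => by
    rw [← hwG n]; exact le_mul_of_one_le_right' le_self_add
  have hleG : ∀ n, w n * G n ≤ 2⁻¹ ^ (n + 1) := fun n => by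
    rw [← hwG n]; gcongr; exact le_add_self
  have hs0 : ∑' n, w n ≠ 0 := fun h => hw0 0 (ENNReal.tsum_eq_zero.1 h 0)
  have hs : ∑' n, w n ≠ ∞ := ne_top_of_le_ne_top hgeo (ENNReal.tsum_le_tsum hle)
  refine ⟨PMF.normalize w hs0 hs, fun n => ?_, ?_⟩
  · rw [PMF.normalize_apply]
    exact mul_ne_zero (hw0 n) (ENNReal.inv_ne_zero.2 hs)
  · simp_rw [PMF.normalize_apply, mul_right_comm]
    rw [ENNReal.tsum_mul_right]
    exact ENNReal.mul_ne_top (ne_top_of_le_ne_top hgeo (ENNReal.tsum_le_tsum hleG))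
      (ENNReal.inv_ne_top.2 hs0)

theorem lintegral_pmf_nat (ρ : PMF ℕ) (f : ℕ → ℝ≥0∞) :
    ∫⁻ n, f n ∂ρ.toMeasure = ∑' n, ρ n * f n := by
  rw [lintegral_countable']
  simp [PMF.toMeasure_apply_singleton, mul_comm]

/-- Semigroup generation requires adding inverses and `1` to a finite generating set; otherwise all
of `Γ` is enumerated. -/
theorem exists_generating_seq {G : Type*} [Group G] (Γ : Subgroup G) (hΓ : (Γ : Set G).Countable) :
    ∃ f : ℕ → G, Set.range f ⊆ Γ ∧ (Γ : Set G) ⊆ Subsemigroup.closure (Set.range f) ∧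
      (Γ.FG → (Set.range f).Finite) := by
  by_cases hfg : Γ.FG
  · obtain ⟨T, hT, hTf⟩ := (Subgroup.fg_iff Γ).1 hfg
    obtain ⟨f, hf⟩ := ((hTf.union hTf.inv).union (Set.finite_singleton 1)).countable.exists_eq_range
      ⟨1, Or.inr rfl⟩
    refine ⟨f, ?_, ?_, fun _ => hf ▸ (hTf.union hTf.inv).union (Set.finite_singleton 1)⟩
    · rw [← hf, ← hT]
      rintro x ((hx | hx) | rfl)
      · exact Subgroup.subset_closure hx
      · exact inv_mem_iff.1 (Subgroup.subset_closure (Set.mem_inv.1 hx))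
      · exact one_mem _
    · intro x hx
      rw [← hT] at hx
      have hx' : x ∈ Submonoid.closure (T ∪ T⁻¹) := by
        rw [← Subgroup.closure_toSubmonoid]; exact hx
      rw [← hf]
      induction hx' using Submonoid.closure_induction with
      | mem y hy => exact Subsemigroup.subset_closure (Or.inl hy)
      | one => exact Subsemigroup.subset_closure (Or.inr rfl)
      | mul y z hy hz ihy ihz =>
        rw [← Subgroup.closure_toSubmonoid] at hy hz
        exact mul_mem (ihy hy) (ihz hz)
  · obtain ⟨f, hf⟩ := hΓ.exists_eq_range ⟨1, one_mem Γ⟩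
    exact ⟨f, hf ▸ le_rfl, hf ▸ Subsemigroup.subset_closure, fun h => absurd h hfg⟩

theorem pow_z (g : Sol) (k : ℕ) : (g ^ k).z = k * g.z := by
  induction k with
  | zero => simp [one_def]
  | succ k ih =>
    rw [pow_succ, mul_def, ih]
    push_cast
    ring

/-- The sequence `a, f 0, f 1, …`. -/
def consSeq {α : Type*} (a : α) (f : ℕ → α) : ℕ → α
  | 0 => a
  | n + 1 => f n

theorem range_consSeq {α : Type*} (a : α) (f : ℕ → α) :
    Set.range (consSeq a f) = insert a (Set.range f) := by
  ext x
  constructor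
  · rintro ⟨_ | n, rfl⟩
    · exact Or.inl rfl
    · exact Or.inr ⟨n, rfl⟩
  · rintro (rfl | ⟨n, rfl⟩)
    · exact ⟨0, rfl⟩
    · exact ⟨n + 1, rfl⟩

theorem tsum_mul_consSeq_ne_top (ρ : PMF ℕ) {α : Type*} (F : α → ℝ≥0∞) {a : α} (ha : F a ≠ ∞)
    {f : ℕ → α} (h : ∑' n, ρ (n + 1) * F (f n) ≠ ∞) :
    ∑' n, ρ n * F (consSeq a f n) ≠ ∞ := by
  rw [tsum_eq_zero_add' ENNReal.summable]
  exact ENNReal.add_ne_top.2 ⟨ENNReal.mul_ne_top (ρ.apply_ne_top 0) ha, h⟩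

end Sol

/-! ### Construction of the step law -/

open Sol in
theorem mainTheorem3 (Γ : Subgroup Sol) (hcount : (Γ : Set Sol).Countable)
    (hplane : ¬ (Γ : Set Sol) ⊆ {g : Sol | g.z = 0}) :
    ∃ μ : PMF Sol,
      Sol.IsNondegenerateOn μ Γ ∧
      Sol.HasFiniteFirstMoment μ.toMeasure ∧
      (∃ ν : Measure ℝ, Sol.IsHarmonicMeasure μ.toMeasure ν ∧ ν ⟂ₘ volume) ∧
      (Γ.FG → μ.support.Finite) := by
  obtain ⟨g, hg, hgz⟩ : ∃ g ∈ Γ, 0 < g.z := by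
    obtain ⟨g, hg, hz⟩ := Set.not_subset.1 hplane
    rcases lt_or_gt_of_ne hz with h | h
    · exact ⟨g⁻¹, inv_mem hg, by simpa [inv_def] using h⟩
    · exact ⟨g, hg, h⟩
  obtain ⟨f, hfΓ, hfgen, hffin⟩ := exists_generating_seq Γ hcount
  let F : Sol → ℝ≥0∞ := fun g => ‖g.z‖ₑ + ‖g.x‖ₑ + riemannianDist 1 g
  have hF : ∀ g, F g ≠ ∞ := fun g => by simp [F, (riemannianDist_one_lt_top g).ne]
  -- The summand `n + 1` gives the index a finite mean. Index `0` gets cost `0` since its letter is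
  -- chosen only after `ρ`.
  obtain ⟨ρ, hρ0, hρ⟩ := exists_pmf_tsum_mul_ne_top (G := consSeq 0 fun n => (n + 1 : ℕ) + F (f n))
    (by rintro (_ | n) <;> simp [consSeq, hF])
  have hρ' : ∑' n, ρ (n + 1) * ((n + 1 : ℕ) + F (f n)) ≠ ∞ :=
    ne_top_of_le_ne_top hρ (by
      rw [tsum_eq_zero_add' (f := fun n => ρ n * _) ENNReal.summable]; exact le_add_self)
  have hmoment : ∀ (H : Sol → ℝ≥0∞), (∀ g, H g ≤ F g) → ∀ a,
      ∫⁻ n, H (consSeq a f n) ∂ρ.toMeasure < ∞ := by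
    intro H hH a
    rw [lintegral_pmf_nat, lt_top_iff_ne_top]
    refine tsum_mul_consSeq_ne_top ρ H (ne_top_of_le_ne_top (hF a) (hH a))
      (ne_top_of_le_ne_top hρ' (ENNReal.tsum_le_tsum fun n => ?_))
    gcongr
    exact (hH _).trans le_add_self
  have hz : ∀ a, Integrable (fun n => (consSeq a f n).z) ρ.toMeasure := fun a =>
    ⟨(measurable_of_countable _).aestronglyMeasurable,
      hmoment (fun g => ‖g.z‖ₑ) (fun g => by simp [F, add_assoc]) a⟩
  have hx : ∀ a, Integrable (fun n => |(consSeq a f n).x|) ρ.toMeasure := fun a =>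
    Integrable.abs ⟨(measurable_of_countable _).aestronglyMeasurable,
      hmoment (fun g => ‖g.x‖ₑ) (fun g => le_add_right le_add_self) a⟩
  have hJ : Integrable (fun n : ℕ => (n : ℝ)) ρ.toMeasure := by
    refine ⟨(measurable_of_countable _).aestronglyMeasurable, ?_⟩
    rw [HasFiniteIntegral, lintegral_pmf_nat, lt_top_iff_ne_top,
      tsum_eq_zero_add' ENNReal.summable]
    refine ENNReal.add_ne_top.2 ⟨by simp,
      ne_top_of_le_ne_top hρ' (ENNReal.tsum_le_tsum fun n => ?_)⟩
    gcongr
    rw [Real.enorm_natCast]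
    exact le_self_add
  -- The drift is affine in the height of letter `0`, with slope `ρ 0 > 0`.
  have hint : ∀ a : Sol, ∫ n, (consSeq a f n).z ∂ρ.toMeasure =
      ∫ n, (consSeq 1 f n).z ∂ρ.toMeasure + (ρ 0).toReal * a.z := by
    intro a
    have hdec : ∀ n, (consSeq a f n).z =
        (consSeq 1 f n).z + Set.indicator {0} (fun _ => a.z) n := by
      rintro (_ | n) <;> simp [consSeq, one_def]
    simp_rw [hdec]
    rw [integral_add (hz 1) ((integrable_const _).indicator (measurableSet_singleton 0)),
      integral_indicator_const _ (measurableSet_singleton 0), Measure.real,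
      PMF.toMeasure_apply_singleton _ _ (measurableSet_singleton 0), smul_eq_mul]
  have hρpos : 0 < (ρ 0).toReal * g.z :=
    mul_pos (ENNReal.toReal_pos (hρ0 0) (ρ.apply_ne_top 0)) hgz
  obtain ⟨k, hk⟩ := exists_nat_gt ((Real.log 2 * (∫ n, (n : ℝ) ∂ρ.toMeasure + 1) -
    ∫ n, (consSeq 1 f n).z ∂ρ.toMeasure) / ((ρ 0).toReal * g.z))
  have hd : Measurable (consSeq (g ^ k) f) := measurable_of_countable _
  have hsupp : (ρ.map (consSeq (g ^ k) f)).support = insert (g ^ k) (Set.range f) := by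
    rw [PMF.support_map, ← range_consSeq, ← Set.image_univ]
    congr 1
    exact Set.eq_univ_of_forall hρ0
  refine ⟨ρ.map (consSeq (g ^ k) f), ?_, ?_, ?_, ?_⟩
  · rw [IsNondegenerateOn, hsupp]
    refine Set.Subset.antisymm ?_
      (hfgen.trans (Subsemigroup.closure_mono (Set.subset_insert _ _)))
    exact Subsemigroup.closure_le (S := Γ.toSubmonoid.toSubsemigroup).2
      (Set.insert_subset (pow_mem hg k) hfΓ)
  · rw [HasFiniteFirstMoment, ← PMF.toMeasure_map _ ρ hd]
    exact (lintegral_map_le _ _).trans_lt (hmoment (riemannianDist 1) (fun g => le_add_self) _)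
  · refine exists_isHarmonicMeasure_mutuallySingular ρ _ (hz _) (hx _) hJ ?_
    rw [hint, pow_z]
    rw [div_lt_iff₀ hρpos] at hk
    linarith
  · intro hfg
    rw [hsupp]
    exact (hffin hfg).insert _
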